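/- Let $\mathcal M$ be one of the following two fields, with an automorphism $\sigma$ and a derivation $\partial$ commuting with $\sigma$. (1) Shift case: $\mathcal M=\mathcal M er(\mathbb C)$ is the field of meromorphic functions on $\mathbb C$, $\sigma: f(x)\mapsto f(x+1)$, and $\partial=\frac{d}{dx}$. (2) $q$-elliptic case: $\mathcal M=\mathcal M er(\mathbb C^*)$ is the field of meromorphic functions on $\mathbb C^*=\mathbb C\smallsetminus\{0\}$, $\sigma: f(x)\mapsto f(qx)$ for a fixed $q\in\mathbb C$ with $q\neq 0$ and $|q|\neq 1$, and $\partial=x\frac{d}{dx}$. More generally, in each of the two cases $\partial$ may be any derivation of $\mathcal M$ that commutes with $\sigma$. Let $\mathcal M^\sigma=\{f\in\mathcal M : \sigma(f)=f\}$, and let $\mathcal F$ be a subfield of $\mathcal M$ with $\mathcal M^\sigma(x)\subset\mathcal F$, such that $\sigma$ restricts to an automorphism of $\mathcal F$ and $\partial(\mathcal F)\subset\mathcal F$. Put $\mathcal K=\{f\in\mathcal F : \sigma(f)=f\}$. A differential polynomial in $Y_1,\dots,Y_n$ over a subfield $k$ of $\mathcal M$ is a polynomial with coefficients in $k$ in the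 independent variables $Y_i^{(j)}$ ($1\le i\le n$, $j\ge 0$); its value at $(y_1,\dots,y_n)\in\mathcal M^n$ is obtained by substituting $\partial^j(y_i)$ for $Y_i^{(j)}$. It is called homogeneous linear if it is homogeneous of degree $1$ in the variables $Y_i^{(j)}$. Let $a_1,\dots,a_n$ be nonzero elements of $\mathcal F$, and let $z_1,\dots,z_n\in\mathcal M$ satisfy $\sigma(z_i)-z_i=a_i$ for $i=1,\dots,n$. Then the following are equivalent: (i) $z_1,\dots,z_n$ satisfy a nontrivial $\partial$-differential relation over $\mathcal F$, that is, there is a nonzero differential polynomial $P$ in $Y_1,\dots,Y_n$ with coefficients in $\mathcal F$ such that $P(z_1,\dots,z_n)=0$; (ii) there are a nonzero homogeneous linear differential polynomial $L$ in $Y_1,\dots,Y_n$ with coefficients in $\mathcal K$ and an element $f\in\mathcal F$ such that $L(a_1,\dots,a_n)=\sigma(f)-f$. -/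

import Mathlib

open Filter Topology

/-- A nonempty connected open subset of the complex plane. -/
class IsComplexDomain (U : Set ℂ) : Prop where
  isOpen : IsOpen U
  isConnected : IsConnected U

instance isComplexDomain_univ : IsComplexDomain Set.univ :=
  ⟨isOpen_univ, isConnected_univ⟩

instance isComplexDomain_compl_zero : IsComplexDomain ({0}ᶜ : Set ℂ) :=
  ⟨isOpen_compl_singleton,
    isConnected_compl_singleton_of_one_lt_rank (by simp) 0⟩

/-- The ring of meromorphic functions on `U`, two functions being identified when they agree on
`U` outside a subset of `U` that is discrete and closed in `U`. -/
def merSubring (U : Set ℂ) : Subring (Germ (codiscreteWithin U) ℂ) where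
  carrier := {g | ∃ f : ℂ → ℂ, MeromorphicOn f U ∧ (f : Germ (codiscreteWithin U) ℂ) = g}
  mul_mem' := by
    rintro _ _ ⟨f, hf, rfl⟩ ⟨g, hg, rfl⟩
    exact ⟨f * g, hf.mul hg, rfl⟩
  one_mem' := ⟨1, MeromorphicOn.const 1, rfl⟩
  add_mem' := by
    rintro _ _ ⟨f, hf, rfl⟩ ⟨g, hg, rfl⟩
    exact ⟨f + g, hf.add hg, rfl⟩
  zero_mem' := ⟨0, MeromorphicOn.const 0, rfl⟩
  neg_mem' := by
    rintro _ ⟨f, hf, rfl⟩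
    exact ⟨-f, hf.neg, rfl⟩

/-- The meromorphic functions on `U`. -/
abbrev Mer (U : Set ℂ) : Type := merSubring U

namespace Mer

/-- The element of `Mer U` given by a meromorphic function on `U`. -/
noncomputable def mk {U : Set ℂ} (f : ℂ → ℂ) (hf : MeromorphicOn f U) : Mer U :=
  ⟨(f : Germ (codiscreteWithin U) ℂ), f, hf, rfl⟩

theorem exists_rep {U : Set ℂ} (g : Mer U) :
    ∃ (f : ℂ → ℂ) (hf : MeromorphicOn f U), mk f hf = g := by
  obtain ⟨_, f, hf, rfl⟩ := g
  exact ⟨f, hf, rfl⟩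

theorem mk_eq_mk {U : Set ℂ} {f g : ℂ → ℂ} {hf : MeromorphicOn f U} {hg : MeromorphicOn g U} :
    mk f hf = mk g hg ↔ f =ᶠ[codiscreteWithin U] g :=
  Subtype.ext_iff.trans Germ.coe_eq

theorem eventually_iff_of_isOpen {U : Set ℂ} (hU : IsOpen U) {p : ℂ → Prop} :
    (∀ᶠ x in codiscreteWithin U, p x) ↔ ∀ x ∈ U, ∀ᶠ y in 𝓝[≠] x, p y := by
  rw [Filter.Eventually, mem_codiscreteWithin_iff_forall_mem_nhdsNE]
  refine forall₂_congr fun x hx => ⟨fun h => ?_, fun h => ?_⟩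
  · filter_upwards [h, nhdsWithin_le_nhds (hU.mem_nhds hx)] with y hy hyU
    exact hy.resolve_right fun h => h hyU
  · filter_upwards [h] with y hy
    exact Or.inl hy

theorem deriv_congr {U : Set ℂ} (hU : IsOpen U) {f g : ℂ → ℂ}
    (h : f =ᶠ[codiscreteWithin U] g) : deriv f =ᶠ[codiscreteWithin U] deriv g := by
  refine (eventually_iff_of_isOpen hU).2 fun x hx => ?_
  have h1 := (eventually_iff_of_isOpen hU).1 h x hx
  filter_upwards [eventually_eventually_nhdsWithin.2 h1, self_mem_nhdsWithin] with y hy hyx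
  rw [isOpen_compl_singleton.nhdsWithin_eq hyx] at hy
  exact EventuallyEq.deriv_eq hy

theorem inv_mem {U : Set ℂ} (g : Mer U) :
    Germ.map (fun w : ℂ => w⁻¹) (g : Germ (codiscreteWithin U) ℂ) ∈ merSubring U := by
  obtain ⟨_, f, hf, rfl⟩ := g
  exact ⟨f⁻¹, hf.inv, rfl⟩

theorem neBot (U : Set ℂ) [hU : IsComplexDomain U] : NeBot (codiscreteWithin U) := by
  obtain ⟨x, hx⟩ := hU.isConnected.nonempty
  rw [neBot_iff, Ne, ← empty_mem_iff_bot, mem_codiscreteWithin_iff_forall_mem_nhdsNE]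
  intro h
  have h1 := h x hx
  obtain ⟨y, hy, hyU⟩ := (nonempty_of_mem (inter_mem h1
    (nhdsWithin_le_nhds (hU.isOpen.mem_nhds hx) : U ∈ 𝓝[≠] x)))
  simp_all

/-- Meromorphic functions on a connected open set form a field. The inverse is taken pointwise. -/
noncomputable instance instField (U : Set ℂ) [hU : IsComplexDomain U] : Field (Mer U) :=
  { (inferInstance : CommRing (Mer U)) with
    inv := fun g => ⟨Germ.map (fun w : ℂ => w⁻¹) (g : Germ (codiscreteWithin U) ℂ), inv_mem g⟩
    exists_pair_ne := by
      have := neBot U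
      refine ⟨0, 1, fun h => ?_⟩
      exact zero_ne_one (congrArg Subtype.val h : (0 : Germ (codiscreteWithin U) ℂ) = 1)
    mul_inv_cancel := by
      intro g hg
      obtain ⟨f, hf, rfl⟩ := exists_rep g
      have hne : ∃ x ∈ U, meromorphicOrderAt f x ≠ ⊤ := by
        by_contra! hcon
        refine hg (mk_eq_mk (hg := MeromorphicOn.const 0) |>.2 ?_)
        exact (eventually_iff_of_isOpen hU.isOpen).2 fun x hx =>
          meromorphicOrderAt_eq_top_iff.1 (hcon x hx)
      obtain ⟨x, hx, hfx⟩ := hne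
      have hev : ∀ᶠ y in codiscreteWithin U, f y ≠ 0 :=
        (eventually_iff_of_isOpen hU.isOpen).2 fun y hy =>
          (meromorphicOrderAt_ne_top_iff_eventually_ne_zero (hf y hy)).1
            (hf.meromorphicOrderAt_ne_top_of_isPreconnected
              hU.isConnected.isPreconnected hx hy hfx)
      refine Subtype.ext (Germ.coe_eq.2 ?_ : (f * f⁻¹ : ℂ → ℂ) = (1 : Germ (codiscreteWithin U) ℂ))
      filter_upwards [hev] with y hy
      simp [hy]
    inv_zero := Subtype.ext (Germ.coe_eq.2 (by simp [EventuallyEq]))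
    nnqsmul := _
    nnqsmul_def := fun _ _ => rfl
    qsmul := _
    qsmul_def := fun _ _ => rfl }

/-- The identity function, as a meromorphic function on `U`. -/
noncomputable def X (U : Set ℂ) : Mer U := mk id MeromorphicOn.id

/-- The derivative of a meromorphic function. -/
noncomputable def derivFun (U : Set ℂ) [hU : IsComplexDomain U] (g : Mer U) : Mer U :=
  ⟨Germ.map' deriv (fun _ _ h => deriv_congr hU.isOpen h) (g : Germ (codiscreteWithin U) ℂ), by
    obtain ⟨_, f, hf, rfl⟩ := g
    exact ⟨deriv f, hf.deriv, rfl⟩⟩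

theorem derivFun_mk {U : Set ℂ} [IsComplexDomain U] (f : ℂ → ℂ) (hf : MeromorphicOn f U) :
    derivFun U (mk f hf) = mk (deriv f) hf.deriv := rfl

theorem eventually_differentiableAt {U : Set ℂ} {f : ℂ → ℂ} (hf : MeromorphicOn f U) :
    ∀ᶠ x in codiscreteWithin U, DifferentiableAt ℂ f x := by
  filter_upwards [hf.analyticAt_mem_codiscreteWithin] with x hx
  exact AnalyticAt.differentiableAt hx

/-- The derivation `d/dx` of the field of meromorphic functions on `U`. -/
noncomputable def ddx (U : Set ℂ) [IsComplexDomain U] : Derivation ℤ (Mer U) (Mer U) :=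
  Derivation.mk'
    (AddMonoidHom.toIntLinearMap
      (AddMonoidHom.mk' (derivFun U) (by
        intro g h
        obtain ⟨f, hf, rfl⟩ := exists_rep g
        obtain ⟨k, hk, rfl⟩ := exists_rep h
        refine mk_eq_mk (hf := (hf.add hk).deriv) (hg := hf.deriv.add hk.deriv) |>.2 ?_
        filter_upwards [eventually_differentiableAt hf, eventually_differentiableAt hk]
          with x h1 h2
        exact deriv_add h1 h2)))
    (by
      intro g h
      obtain ⟨f, hf, rfl⟩ := exists_rep g
      obtain ⟨k, hk, rfl⟩ := exists_rep h
      refine mk_eq_mk (hf := (hf.mul hk).deriv)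
        (hg := (hf.mul hk.deriv).add (hk.mul hf.deriv)) |>.2 ?_
      filter_upwards [eventually_differentiableAt hf, eventually_differentiableAt hk]
        with x h1 h2
      have := deriv_mul h1 h2
      simp only [Pi.add_apply, Pi.mul_apply]
      rw [this]
      ring)

/-- The derivation `x d/dx` of the field of meromorphic functions on `U`. -/
noncomputable def euler (U : Set ℂ) [IsComplexDomain U] : Derivation ℤ (Mer U) (Mer U) :=
  X U • ddx U

theorem tendsto_codiscreteWithin (e : ℂ ≃ₜ ℂ) {U : Set ℂ} (hU : IsOpen U)
    (heU : ∀ x, e x ∈ U ↔ x ∈ U) : Tendsto e (codiscreteWithin U) (codiscreteWithin U) := by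
  intro s hs
  refine (eventually_iff_of_isOpen hU (p := fun x => e x ∈ s)).2 fun x hx => ?_
  have h1 := (eventually_iff_of_isOpen hU (p := fun x => x ∈ s)).1 hs (e x) ((heU x).2 hx)
  have h2 : Tendsto e (𝓝[≠] x) (𝓝[≠] (e x)) :=
    tendsto_nhdsWithin_of_tendsto_nhds_of_eventually_within _
      (e.continuous.continuousAt.mono_left nhdsWithin_le_nhds)
      (by filter_upwards [self_mem_nhdsWithin] with y hy using fun h => hy (e.injective h))
  exact h2.eventually h1

/-- Composition `f ↦ f ∘ e` with an analytic homeomorphism `e` of the plane that preserves `U`. -/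
noncomputable def precompFun (U : Set ℂ) [hU : IsComplexDomain U] (e : ℂ ≃ₜ ℂ)
    (heU : ∀ x, e x ∈ U ↔ x ∈ U) (he : ∀ x, AnalyticAt ℂ e x) (g : Mer U) : Mer U :=
  ⟨(g : Germ (codiscreteWithin U) ℂ).compTendsto e (tendsto_codiscreteWithin e hU.isOpen heU), by
    obtain ⟨_, f, hf, rfl⟩ := g
    exact ⟨f ∘ e, fun x hx => (hf (e x) ((heU x).2 hx)).comp_analyticAt (he x), rfl⟩⟩

/-- Composition with an analytic automorphism of the plane, as an automorphism of `Mer U`. -/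
noncomputable def precomp (U : Set ℂ) [IsComplexDomain U] (e : ℂ ≃ₜ ℂ)
    (heU : ∀ x, e x ∈ U ↔ x ∈ U) (he : ∀ x, AnalyticAt ℂ e x)
    (he' : ∀ x, AnalyticAt ℂ e.symm x) : Mer U ≃+* Mer U where
  toFun := precompFun U e heU he
  invFun := precompFun U e.symm (fun x => by simp [← heU (e.symm x)]) he'
  left_inv := by
    intro g
    obtain ⟨f, hf, rfl⟩ := exists_rep g
    refine Subtype.ext (congrArg _ ?_ : ((f ∘ e) ∘ e.symm : Germ (codiscreteWithin U) ℂ) = f)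
    funext x
    simp
  right_inv := by
    intro g
    obtain ⟨f, hf, rfl⟩ := exists_rep g
    refine Subtype.ext (congrArg _ ?_ : ((f ∘ e.symm) ∘ e : Germ (codiscreteWithin U) ℂ) = f)
    funext x
    simp
  map_mul' := by
    intro g h
    obtain ⟨f, hf, rfl⟩ := exists_rep g
    obtain ⟨k, hk, rfl⟩ := exists_rep h
    rfl
  map_add' := by
    intro g h
    obtain ⟨f, hf, rfl⟩ := exists_rep g
    obtain ⟨k, hk, rfl⟩ := exists_rep h
    rfl

/-- The shift `f(x) ↦ f(x + 1)` on the field of meromorphic functions on the complex plane. -/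
noncomputable def shift : Mer Set.univ ≃+* Mer Set.univ :=
  precomp Set.univ (Homeomorph.addRight (1 : ℂ)) (fun _ => by simp)
    (fun _ => analyticAt_id.add analyticAt_const) (fun _ => analyticAt_id.add analyticAt_const)

/-- The dilation `f(x) ↦ f(q x)` on the field of meromorphic functions on the punctured plane. -/
noncomputable def dilation (q : ℂ) (hq : q ≠ 0) : Mer {0}ᶜ ≃+* Mer {0}ᶜ :=
  precomp {0}ᶜ (Homeomorph.mulLeft₀ q hq) (fun _ => by simp [hq])
    (fun _ => analyticAt_const.mul analyticAt_id) (fun _ => analyticAt_const.mul analyticAt_id)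

theorem shift_mk (f : ℂ → ℂ) (hf : MeromorphicOn f Set.univ)
    (hf' : MeromorphicOn (fun x => f (x + 1)) Set.univ) :
    shift (mk f hf) = mk (fun x => f (x + 1)) hf' := rfl

theorem dilation_mk (q : ℂ) (hq : q ≠ 0) (f : ℂ → ℂ) (hf : MeromorphicOn f {0}ᶜ)
    (hf' : MeromorphicOn (fun x => f (q * x)) {0}ᶜ) :
    dilation q hq (mk f hf) = mk (fun x => f (q * x)) hf' := rfl

theorem ddx_mk {U : Set ℂ} [IsComplexDomain U] (f : ℂ → ℂ) (hf : MeromorphicOn f U) :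
    ddx U (mk f hf) = mk (deriv f) hf.deriv := rfl

theorem euler_mk {U : Set ℂ} [IsComplexDomain U] (f : ℂ → ℂ) (hf : MeromorphicOn f U) :
    euler U (mk f hf) = mk (fun x => x * deriv f x) (MeromorphicOn.id.mul hf.deriv) := rfl

theorem meromorphicOn_shift {f : ℂ → ℂ} (hf : MeromorphicOn f Set.univ) :
    MeromorphicOn (fun x => f (x + 1)) Set.univ := fun x _ =>
  MeromorphicAt.comp_analyticAt (g := fun x : ℂ => x + 1) (hf (x + 1) trivial)
    (analyticAt_id.add analyticAt_const)

theorem meromorphicOn_dilation {q : ℂ} (hq : q ≠ 0) {f : ℂ → ℂ} (hf : MeromorphicOn f {0}ᶜ) :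
    MeromorphicOn (fun x => f (q * x)) {0}ᶜ := fun x hx =>
  MeromorphicAt.comp_analyticAt (g := fun x : ℂ => q * x) (hf (q * x) (mul_ne_zero hq hx))
    (analyticAt_const.mul analyticAt_id)

/-- `d/dx` commutes with the shift. -/
theorem ddx_shift (g : Mer Set.univ) : ddx _ (shift g) = shift (ddx _ g) := by
  obtain ⟨f, hf, rfl⟩ := exists_rep g
  rw [shift_mk f hf (meromorphicOn_shift hf), ddx_mk, ddx_mk,
    shift_mk _ _ (meromorphicOn_shift hf.deriv), mk_eq_mk]
  refine Eventually.of_forall fun x => ?_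
  exact deriv_comp_add_const f 1 x

/-- `x d/dx` commutes with the dilations. -/
theorem euler_dilation (q : ℂ) (hq : q ≠ 0) (g : Mer {0}ᶜ) :
    euler _ (dilation q hq g) = dilation q hq (euler _ g) := by
  obtain ⟨f, hf, rfl⟩ := exists_rep g
  have hf' : MeromorphicOn (fun x => x * deriv f x) {0}ᶜ := MeromorphicOn.id.mul hf.deriv
  rw [dilation_mk q hq f hf (meromorphicOn_dilation hq hf), euler_mk, euler_mk,
    dilation_mk q hq _ hf' (meromorphicOn_dilation hq hf'), mk_eq_mk]
  refine Eventually.of_forall fun x => ?_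
  have h := deriv_comp_mul_left q f x
  simp only [h, smul_eq_mul]
  ring

end Mer

section Criterion

/-- The subfield of elements fixed by an automorphism `σ`. -/
def fixedSubfield {M : Type*} [Field M] (σ : M ≃+* M) : Subfield M :=
  RingHom.eqLocusField (σ : M →+* M) (RingHom.id M)

/-- `F` is a `(σ, ∂)`-subfield of `M`: `σ` restricts to an automorphism of `F` and `∂` to a
derivation of `F`. -/
structure IsDiffDiffSubfield {M : Type*} [Field M] (σ : M ≃+* M) (D : Derivation ℤ M M)
    (F : Subfield M) : Prop where
  map_mem : ∀ f ∈ F, σ f ∈ F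
  symm_mem : ∀ f ∈ F, σ.symm f ∈ F
  deriv_mem : ∀ f ∈ F, D f ∈ F

/-- The value at `(z₁, …, zₙ)` of a differential polynomial in `Y₁, …, Yₙ` with coefficients in
the subfield `F`. The variable `(i, j)` stands for the `j`-th derivative of `Yᵢ`. -/
noncomputable def evalDiffPoly {M : Type*} [Field M] (D : Derivation ℤ M M) {F : Subfield M}
    {n : ℕ} (z : Fin n → M) (P : MvPolynomial (Fin n × ℕ) F) : M :=
  MvPolynomial.aeval (fun p : Fin n × ℕ => D^[p.2] (z p.1)) P

/-- For all nonzero `a₁, …, aₙ` in `F` and all `z₁, …, zₙ` in `M` with `σ(zᵢ) - zᵢ = aᵢ`: the `zᵢ`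
satisfy a nontrivial differential relation over `F` if and only if there are a nonzero homogeneous
linear differential polynomial `L`, with coefficients in the field of `σ`-constants of `F`, and
some `f` in `F` such that `L(a₁, …, aₙ) = σ(f) - f`. -/
def TranscendenceCriterion {M : Type*} [Field M] (σ : M ≃+* M) (D : Derivation ℤ M M)
    (F : Subfield M) : Prop :=
  ∀ (n : ℕ) (a z : Fin n → M), (∀ i, a i ∈ F) → (∀ i, a i ≠ 0) →
    (∀ i, σ (z i) - z i = a i) →
    ((∃ P : MvPolynomial (Fin n × ℕ) F, P ≠ 0 ∧ evalDiffPoly D z P = 0) ↔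
      ∃ L : MvPolynomial (Fin n × ℕ) (F ⊓ fixedSubfield σ : Subfield M),
        L ≠ 0 ∧ L.IsHomogeneous 1 ∧ ∃ f ∈ F, evalDiffPoly D a L = σ f - f)

end Criterion

/-!
The derivatives `u_p = D^j z_i`, for `p = (i, j)`, satisfy `σ(u_p) - u_p = b_p` with
`b_p = D^j a_i ∈ F`, because `D` commutes with `σ`. The theorem is therefore an instance of a
statement on algebraic dependence: the `u_p` are algebraically dependent over `F` if and only if some
nontrivial linear combination of the `b_p` with `σ`-invariant coefficients has the form `σ(f) - f`
with `f ∈ F`. The only facts on meromorphic functions that enter are that they form a field of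
characteristic zero, and that the hypotheses place every `σ`-invariant function in `F`.

If `∑ c_p b_p = σ(f) - f`, then `∑ c_p u_p - f` is invariant, hence lies in `F`, and this is a
relation of degree one among the `u_p`.

Conversely, the operator `τ P = P^σ(X + b)` on `F[X_p]` satisfies `(τ P)(u) = σ(P(u))`, so it
preserves the relations. On coefficients of top degree it acts as `σ`. After normalizing one of them
to `1`, the relation `τ P - P` is smaller than `P`; by descent there is a nonzero relation with
`τ P = P` (`exists_twistedTranslate_eq_self`). It is not constant. Partial derivatives commute with
`τ`, so in characteristic zero repeated differentiation leads to an invariant polynomial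
`c_0 + ∑ c_p X_p` of degree one (`exists_linear_relation`). Its invariance says that the `c_p` are
fixed by `σ` and that `∑ c_p b_p = c_0 - σ(c_0)`.
-/

/-! ### Twisted translations of a polynomial ring -/

namespace MvPolynomial

variable {ι : Type*} {F : Type*} [Field F]

/-- The ring endomorphism `P ↦ P^σ(X + b)` of `F[X_i]`: it acts by `σ` on the coefficients and
translates the variable `X_i` by `b_i`. -/
noncomputable def twistedTranslate (σ : F →+* F) (b : ι → F) :
    MvPolynomial ι F →+* MvPolynomial ι F :=
  eval₂Hom (C.comp σ) fun i => X i + C (b i)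

@[simp]
theorem twistedTranslate_C (σ : F →+* F) (b : ι → F) (c : F) :
    twistedTranslate σ b (C c) = C (σ c) := by
  simp [twistedTranslate]

@[simp]
theorem twistedTranslate_X (σ : F →+* F) (b : ι → F) (i : ι) :
    twistedTranslate σ b (X i) = X i + C (b i) := by
  simp [twistedTranslate]

theorem pderiv_twistedTranslate (σ : F →+* F) (b : ι → F) (i : ι) (P : MvPolynomial ι F) :
    pderiv i (twistedTranslate σ b P) = twistedTranslate σ b (pderiv i P) := by
  classical
  induction P using MvPolynomial.induction_on with
  | C c => simp
  | add P Q hP hQ => simp [hP, hQ]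
  | mul_X P j hP =>
    rcases eq_or_ne j i with rfl | hij
    · simp [hP]
    · simp [hP, pderiv_X_of_ne hij]

theorem coeff_twistedTranslate_monomial (σ : F →+* F) (b : ι → F) (s : ι →₀ ℕ) (c : F) :
    ∀ m : ι →₀ ℕ, (monomial s c).totalDegree ≤ m.degree →
      coeff m (twistedTranslate σ b (monomial s c)) = σ (coeff m (monomial s c)) := by
  classical
  refine MvPolynomial.induction_on_monomial (fun c m _ => ?_) (fun P i hP m hm => ?_) s c
  · simp [coeff_C, apply_ite σ]
  · rcases eq_or_ne P 0 with rfl | hP0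
    · simp
    rw [totalDegree_mul_of_isDomain hP0 (X_ne_zero i), totalDegree_X] at hm
    have hm' : coeff m P = 0 := coeff_eq_zero_of_totalDegree_lt (Nat.lt_of_succ_le hm)
    rw [map_mul, twistedTranslate_X, mul_add, coeff_add, mul_comm _ (C _), coeff_C_mul, hP m (by lia),
      hm', coeff_mul_X', coeff_mul_X']
    split_ifs with hi
    · have hle : Finsupp.single i 1 ≤ m := by
        simpa [Finsupp.single_le_iff, Nat.one_le_iff_ne_zero] using hi
      have hdeg := congrArg Finsupp.degree (tsub_add_cancel_of_le hle)
      simp only [map_add, Finsupp.degree_single] at hdeg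
      rw [hP _ (by lia), map_zero, mul_zero, add_zero]
    · simp

/-- The coefficients of degree at least `deg P` do not see the translation. -/
theorem coeff_twistedTranslate (σ : F →+* F) (b : ι → F) (P : MvPolynomial ι F)
    {m : ι →₀ ℕ} (hm : P.totalDegree ≤ m.degree) :
    coeff m (twistedTranslate σ b P) = σ (coeff m P) := by
  conv_lhs => rw [P.as_sum]
  conv_rhs => rw [P.as_sum]
  simp only [map_sum, coeff_sum]
  exact Finset.sum_congr rfl fun s hs =>
    coeff_twistedTranslate_monomial σ b s _ m
      (((totalDegree_monomial_le s _).trans (le_totalDegree hs)).trans hm)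

theorem totalDegree_le_iff_coeff {P : MvPolynomial ι F} {d : ℕ} :
    P.totalDegree ≤ d ↔ ∀ m : ι →₀ ℕ, d < m.degree → coeff m P = 0 := by
  refine ⟨fun h m hm => coeff_eq_zero_of_totalDegree_lt (h.trans_lt hm), fun h => ?_⟩
  refine Finset.sup_le fun m hm => not_lt.1 fun hlt => mem_support_iff.1 hm (h m hlt)

/-- Evaluation at a point `u` with `σ(u_i) = u_i + b_i` intertwines `σ` with the twisted
translation. -/
theorem aeval_twistedTranslate {M : Type*} [Field M] [Algebra F M] (σ : M →+* M) (σF : F →+* F)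
    (hσ : ∀ c, σ (algebraMap F M c) = algebraMap F M (σF c)) (b : ι → F) (u : ι → M)
    (hu : ∀ i, σ (u i) = u i + algebraMap F M (b i)) (P : MvPolynomial ι F) :
    aeval u (twistedTranslate σF b P) = σ (aeval u P) := by
  induction P using MvPolynomial.induction_on with
  | C c => simp [hσ]
  | add P Q hP hQ => simp [hP, hQ]
  | mul_X P i hP => simp [hP, hu]

/-! ### From an algebraic relation to an invariant one -/

/-- The monomials of maximal degree of a polynomial. -/
noncomputable def topSupport (P : MvPolynomial ι F) : Finset (ι →₀ ℕ) :=
  {m ∈ P.support | P.totalDegree ≤ m.degree}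

theorem topSupport_nonempty {P : MvPolynomial ι F} (hP : P ≠ 0) : P.topSupport.Nonempty := by
  obtain ⟨m, hm, h⟩ := Finset.exists_mem_eq_sup P.support (support_nonempty.2 hP)
    fun s => s.sum fun _ e => e
  exact ⟨m, Finset.mem_filter.2 ⟨hm, h.le⟩⟩

/-- If an algebraic relation among the `u_i` exists, then one exists that is invariant under the
twisted translation. Indeed, if a coefficient of top degree is normalized to `1`, then
`P^σ(X + b) - P` has a smaller degree, or the same degree and fewer monomials of that degree. -/
theorem exists_twistedTranslate_eq_self {M : Type*} [Field M] [Algebra F M] (σ : M →+* M)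
    (σF : F →+* F) (hσ : ∀ c, σ (algebraMap F M c) = algebraMap F M (σF c)) (b : ι → F)
    (u : ι → M) (hu : ∀ i, σ (u i) = u i + algebraMap F M (b i)) (P : MvPolynomial ι F)
    (hP : P ≠ 0) (hPu : aeval u P = 0) :
    ∃ Q : MvPolynomial ι F, Q ≠ 0 ∧ aeval u Q = 0 ∧ twistedTranslate σF b Q = Q := by
  obtain ⟨m, hm⟩ := topSupport_nonempty hP
  obtain ⟨hmP, hmd⟩ := Finset.mem_filter.1 hm
  have hc : coeff m P ≠ 0 := mem_support_iff.1 hmP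
  set P' : MvPolynomial ι F := C (coeff m P)⁻¹ * P with hP'
  have hcoeff (k : ι →₀ ℕ) : coeff k P' = (coeff m P)⁻¹ * coeff k P := coeff_C_mul _ _ _
  have hdeg : P'.totalDegree ≤ P.totalDegree := totalDegree_le_iff_coeff.2 fun k hk => by
    rw [hcoeff, coeff_eq_zero_of_totalDegree_lt hk, mul_zero]
  have hP'u : aeval u P' = 0 := by simp [hP', hPu]
  set R := twistedTranslate σF b P' - P' with hR
  have hRu : aeval u R = 0 := by
    rw [hR, map_sub, aeval_twistedTranslate σ σF hσ b u hu, hP'u, map_zero, sub_zero]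
  rcases eq_or_ne R 0 with hR0 | hR0
  · refine ⟨P', mul_ne_zero (by simpa using hc) hP, hP'u, sub_eq_zero.1 hR0⟩
  have hRcoeff (k : ι →₀ ℕ) (hk : P.totalDegree ≤ k.degree) :
      coeff k R = σF (coeff k P') - coeff k P' := by
    rw [hR, coeff_sub, coeff_twistedTranslate σF b P' (hdeg.trans hk)]
  have hRdeg : R.totalDegree ≤ P.totalDegree := totalDegree_le_iff_coeff.2 fun k hk => by
    rw [hRcoeff k hk.le, hcoeff, coeff_eq_zero_of_totalDegree_lt hk, mul_zero, map_zero, sub_zero]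
  have hlex : Prod.Lex (· < ·) (· < ·) (R.totalDegree, R.topSupport.card)
      (P.totalDegree, P.topSupport.card) := by
    rcases hRdeg.lt_or_eq with hlt | heq
    · exact Prod.Lex.left _ _ hlt
    rw [heq]
    refine Prod.Lex.right _ (Finset.card_lt_card ?_)
    refine (Finset.ssubset_iff_of_subset fun k hk => ?_).2 ⟨m, hm, fun hmR => ?_⟩
    · obtain ⟨hk, hkd⟩ := Finset.mem_filter.1 hk
      rw [heq] at hkd
      refine Finset.mem_filter.2 ⟨mem_support_iff.2 fun h0 => mem_support_iff.1 hk ?_, hkd⟩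
      rw [hRcoeff k hkd, hcoeff, h0, mul_zero, map_zero, sub_zero]
    · refine mem_support_iff.1 (Finset.mem_filter.1 hmR).1 ?_
      -- the coefficient of `P'` at `m` is `1`, which is fixed by `σ`
      rw [hRcoeff m hmd, hcoeff, inv_mul_cancel₀ hc, map_one, sub_self]
  exact exists_twistedTranslate_eq_self σ σF hσ b u hu R hR0 hRu
termination_by (P.totalDegree, P.topSupport.card)
decreasing_by exact hlex

/-! ### From an invariant polynomial to a linear relation -/

theorem totalDegree_pderiv_lt {P : MvPolynomial ι F} (hP : 0 < P.totalDegree) (i : ι) :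
    (pderiv i P).totalDegree < P.totalDegree := by
  refine (totalDegree_le_iff_coeff.2 fun m hm => ?_).trans_lt (Nat.sub_one_lt_of_lt hP)
  rw [coeff_pderiv, coeff_eq_zero_of_totalDegree_lt, zero_mul]
  change _ < Finsupp.degree _
  rw [map_add, Finsupp.degree_single]
  lia

theorem totalDegree_le_one_of_pderiv [CharZero F] {P : MvPolynomial ι F}
    (hP : ∀ i, (pderiv i P).totalDegree = 0) : P.totalDegree ≤ 1 := by
  refine totalDegree_le_iff_coeff.2 fun m hm => ?_
  obtain ⟨i, hi⟩ := Finsupp.support_nonempty_iff.2 fun h : m = 0 => by simp [h] at hm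
  have hle : Finsupp.single i 1 ≤ m := by
    simpa [Finsupp.single_le_iff, Nat.one_le_iff_ne_zero] using hi
  obtain ⟨k, rfl⟩ := exists_add_of_le hle
  rw [map_add, Finsupp.degree_single] at hm
  have h := coeff_pderiv (i := i) P k
  rw [coeff_eq_zero_of_totalDegree_lt ((hP i).trans_lt (show 0 < k.degree by lia))] at h
  rw [add_comm]
  exact (mul_eq_zero.1 h.symm).resolve_right (Nat.cast_add_one_ne_zero _)

theorem eq_affine_of_totalDegree_le_one {P : MvPolynomial ι F} (hP : P.totalDegree ≤ 1) :
    P = C (coeff 0 P) + ∑ i ∈ P.vars, C (coeff (Finsupp.single i 1) P) * X i := by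
  classical
  ext m
  rw [coeff_add, coeff_sum]
  simp only [coeff_C_mul, coeff_C, coeff_X]
  rcases lt_or_ge 1 m.degree with hm | hm
  · rw [coeff_eq_zero_of_totalDegree_lt (hP.trans_lt hm), if_neg (by rintro rfl; simp at hm),
      zero_add, Finset.sum_eq_zero fun i _ => ?_]
    rw [if_neg (by rintro rfl; simp at hm), mul_zero]
  rcases eq_or_ne m 0 with rfl | hm0
  · simp
  obtain ⟨j, rfl⟩ : ∃ j, m = Finsupp.single j 1 := by
    obtain ⟨j, hj⟩ := Finsupp.support_nonempty_iff.2 hm0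
    have hle : Finsupp.single j 1 ≤ m := by
      simpa [Finsupp.single_le_iff, Nat.one_le_iff_ne_zero] using hj
    obtain ⟨k, rfl⟩ := exists_add_of_le hle
    rw [map_add, Finsupp.degree_single, add_le_iff_nonpos_right, nonpos_iff_eq_zero,
      Finsupp.degree_eq_zero_iff] at hm
    exact ⟨j, by rw [hm, add_zero]⟩
  rw [if_neg hm0.symm, zero_add, Finset.sum_eq_single j]
  · simp
  · intro i _ hij
    rw [if_neg fun h => hij (Finsupp.single_left_injective one_ne_zero h), mul_zero]
  · intro hj
    rw [if_pos rfl, mul_one]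
    by_contra h
    exact hj (mem_vars_iff_mem_support j |>.2 ⟨_, mem_support_iff.2 h, by simp⟩)

/-- An invariant nonconstant polynomial yields a linear relation between the `b_i` modulo the image
of `σ - 1`. Differentiation with respect to the variables preserves invariance and lowers the
degree, so the polynomial may be taken to be affine. -/
theorem exists_linear_relation [CharZero F] (σ : F →+* F) (b : ι → F) (P : MvPolynomial ι F)
    (hP : 0 < P.totalDegree) (hinv : twistedTranslate σ b P = P) :
    ∃ (s : Finset ι) (c : ι → F), (∃ i ∈ s, c i ≠ 0) ∧ (∀ i, σ (c i) = c i) ∧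
      ∃ f, ∑ i ∈ s, c i * b i = σ f - f := by
  by_cases h : ∃ i, 0 < (pderiv i P).totalDegree
  · obtain ⟨i, hi⟩ := h
    exact exists_linear_relation σ b (pderiv i P) hi (by rw [← pderiv_twistedTranslate, hinv])
  have hd := totalDegree_le_one_of_pderiv fun i => Nat.eq_zero_of_not_pos fun hi => h ⟨i, hi⟩
  have haff := eq_affine_of_totalDegree_le_one hd
  have hσ (i : ι) : σ (coeff (Finsupp.single i 1) P) = coeff (Finsupp.single i 1) P := by
    rw [← coeff_twistedTranslate σ b P (by simpa using hd), hinv]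
  refine ⟨P.vars, fun i => coeff (Finsupp.single i 1) P, ?_, hσ, -coeff 0 P, ?_⟩
  · by_contra! h0
    rw [Finset.sum_eq_zero fun i hi => by rw [h0 i hi, C_0, zero_mul], add_zero] at haff
    exact hP.ne' (totalDegree_eq_zero_iff_eq_C.2 haff)
  · have h1 := hinv
    rw [haff] at h1
    simp only [map_add, map_sum, map_mul, twistedTranslate_C, twistedTranslate_X, hσ, mul_add,
      Finset.sum_add_distrib] at h1
    refine C_injective ι F ?_
    simp only [map_sum, map_mul, map_sub, map_neg]
    linear_combination h1
termination_by P.totalDegree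
decreasing_by exact totalDegree_pderiv_lt hP i

end MvPolynomial

/-! ### The criterion for an abstract field -/

section Criterion

open MvPolynomial

variable {M : Type*} [Field M]

/-- A homogeneous linear form with `σ`-invariant coefficients commutes with the difference operator
`σ - 1`. -/
theorem map_aeval_sub_of_isHomogeneous_one {ι : Type*} {K : Subfield M} (σ : M →+* M)
    (hK : ∀ c ∈ K, σ c = c) {u b : ι → M} (hu : ∀ i, σ (u i) - u i = b i)
    {L : MvPolynomial ι K} (hL : L.IsHomogeneous 1) :
    σ (aeval u L) - aeval u L = aeval b L := by
  rw [eq_affine_of_totalDegree_le_one hL.totalDegree_le,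
    hL.coeff_eq_zero (d := 0) (by simp)]
  simp only [map_zero, zero_add, map_sum, map_mul, aeval_C, aeval_X, ← Finset.sum_sub_distrib]
  refine Finset.sum_congr rfl fun i _ => ?_
  rw [← hu i, show σ (algebraMap K M _) = _ from hK _ (Subtype.property _), mul_sub]

theorem iterate_derivation_map_sub {σ : M ≃+* M} {D : Derivation ℤ M M}
    (hcomm : ∀ g, D (σ g) = σ (D g)) {a z : M} (h : σ z - z = a) (j : ℕ) :
    σ (D^[j] z) - D^[j] z = D^[j] a := by
  induction j with
  | zero => exact h
  | succ j ih => rw [Function.iterate_succ_apply', Function.iterate_succ_apply', ← ih, map_sub,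
      hcomm]

/-- The criterion holds for every field of characteristic zero with an automorphism and a commuting
derivation, as soon as `F` contains all constants of the automorphism. The derivatives `D^j z_i` are
then solutions of the difference equations with right-hand sides `D^j a_i`, so that differential
relations are algebraic relations among solutions of such equations. -/
theorem transcendenceCriterion_of_commute [CharZero M] {σ : M ≃+* M} {D : Derivation ℤ M M}
    (hcomm : ∀ g, D (σ g) = σ (D g)) {F : Subfield M} (hF : IsDiffDiffSubfield σ D F)
    (hfix : fixedSubfield σ ≤ F) : TranscendenceCriterion σ D F := by
  intro n a z haF _ hz
  have hza (p : Fin n × ℕ) : σ (D^[p.2] (z p.1)) - D^[p.2] (z p.1) = D^[p.2] (a p.1) :=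
    iterate_derivation_map_sub hcomm (hz p.1) p.2
  have hDaF (p : Fin n × ℕ) : D^[p.2] (a p.1) ∈ F :=
    Function.Iterate.rec (· ∈ F) (haF p.1) hF.deriv_mem p.2
  constructor
  · rintro ⟨P, hP, hPz⟩
    let σF : F →+* F := (σ : M →+* M).restrict F F hF.map_mem
    let b (p : Fin n × ℕ) : F := ⟨D^[p.2] (a p.1), hDaF p⟩
    obtain ⟨Q, hQ, hQz, hQinv⟩ := exists_twistedTranslate_eq_self (σ : M →+* M) σF (fun _ => rfl) b
      (fun p : Fin n × ℕ => D^[p.2] (z p.1)) (fun p => eq_add_of_sub_eq' (hza p)) P hP hPz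
    have hQd : 0 < Q.totalDegree := by
      refine Nat.pos_of_ne_zero fun h0 => hQ ?_
      rw [totalDegree_eq_zero_iff_eq_C] at h0
      rw [h0, aeval_C, map_eq_zero] at hQz
      rw [h0, hQz, C_0]
    obtain ⟨s, c, ⟨i, hi, hci⟩, hc, f, hf⟩ := exists_linear_relation σF b Q hQd hQinv
    let c' (p : Fin n × ℕ) : (F ⊓ fixedSubfield σ : Subfield M) :=
      ⟨c p, (c p).2, congrArg Subtype.val (hc p)⟩
    refine ⟨∑ p ∈ s, C (c' p) * X p, fun h0 => hci ?_,
      IsHomogeneous.sum _ _ _ fun p _ => isHomogeneous_C_mul_X _ _, f, f.2, ?_⟩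
    · have h1 := congrArg (coeff (Finsupp.single i 1)) h0
      classical
      rw [coeff_sum, Finset.sum_eq_single i, coeff_C_mul, coeff_X, if_pos rfl, mul_one, coeff_zero] at h1
      · have h2 : ((c' i : M)) = 0 := by rw [h1]; rfl
        exact Subtype.ext h2
      · intro j _ hji
        rw [coeff_C_mul, coeff_X, if_neg fun h =>
          hji (Finsupp.single_left_injective one_ne_zero h), mul_zero]
      · exact fun h => absurd hi h
    · have h1 := congrArg Subtype.val hf
      simp only [AddSubmonoidClass.coe_finsetSum, MulMemClass.coe_mul] at h1
      simp only [evalDiffPoly, map_sum, map_mul, aeval_C, aeval_X]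
      exact h1
  · rintro ⟨L, hL0, hL, f, hfF, hf⟩
    have hfixed := map_aeval_sub_of_isHomogeneous_one (σ : M →+* M)
      (fun c (hc : c ∈ F ⊓ fixedSubfield σ) => hc.2) hza hL
    set w := aeval (fun p : Fin n × ℕ => D^[p.2] (z p.1)) L with hw
    -- `w - f` is fixed by `σ`, hence lies in `F`
    have hσw : σ w - w = σ f - f := hfixed.trans hf
    have hwf : w - f ∈ fixedSubfield σ := by
      change σ (w - f) = w - f
      rw [map_sub]
      linear_combination hσw
    have hwF : w ∈ F := by simpa using add_mem (hfix hwf) hfF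
    let incl : (F ⊓ fixedSubfield σ : Subfield M) →+* F := Subfield.inclusion inf_le_left
    refine ⟨map incl L - C ⟨w, hwF⟩, fun h0 => ?_, ?_⟩
    · rw [sub_eq_zero] at h0
      have h1 := (hL.map incl).totalDegree
        (((map_injective incl incl.injective).ne_iff' (map_zero _)).2 hL0)
      rw [h0, totalDegree_C] at h1
      exact zero_ne_one h1
    · rw [evalDiffPoly, map_sub, aeval_C, aeval_def, eval₂_map]
      exact sub_self w

end Criterion

/-! ### The fields of meromorphic functions -/

namespace Mer

theorem charZero (U : Set ℂ) [IsComplexDomain U] : CharZero (Mer U) := by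
  have := neBot U
  refine charZero_of_inj_zero fun k hk => ?_
  have h1 : ((fun _ => (k : ℂ) : ℂ → ℂ) : Germ (codiscreteWithin U) ℂ) = (fun _ => 0 : ℂ → ℂ) :=
    congrArg Subtype.val hk
  obtain ⟨x, hx : (k : ℂ) = 0⟩ := (Germ.coe_eq.1 h1).exists
  exact_mod_cast hx

end Mer

theorem mainTheorem2 :
    -- the shift case, with the derivation `d/dx`
    (∀ F : Subfield (Mer Set.univ),
      IsDiffDiffSubfield Mer.shift (Mer.ddx Set.univ) F →
      fixedSubfield Mer.shift ≤ F → Mer.X Set.univ ∈ F →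
      TranscendenceCriterion Mer.shift (Mer.ddx Set.univ) F) ∧
    -- the `q`-elliptic case, with the derivation `x d/dx`
    (∀ (q : ℂ) (hq : q ≠ 0), ‖q‖ ≠ 1 →
      ∀ F : Subfield (Mer {0}ᶜ),
        IsDiffDiffSubfield (Mer.dilation q hq) (Mer.euler {0}ᶜ) F →
        fixedSubfield (Mer.dilation q hq) ≤ F → Mer.X {0}ᶜ ∈ F →
        TranscendenceCriterion (Mer.dilation q hq) (Mer.euler {0}ᶜ) F) ∧
    -- the same two cases, with any derivation that commutes with the automorphism
    (∀ D : Derivation ℤ (Mer Set.univ) (Mer Set.univ),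
      (∀ g, D (Mer.shift g) = Mer.shift (D g)) →
      ∀ F : Subfield (Mer Set.univ),
        IsDiffDiffSubfield Mer.shift D F →
        fixedSubfield Mer.shift ≤ F → Mer.X Set.univ ∈ F →
        TranscendenceCriterion Mer.shift D F) ∧
    (∀ (q : ℂ) (hq : q ≠ 0), ‖q‖ ≠ 1 →
      ∀ D : Derivation ℤ (Mer {0}ᶜ) (Mer {0}ᶜ),
        (∀ g, D (Mer.dilation q hq g) = Mer.dilation q hq (D g)) →
        ∀ F : Subfield (Mer {0}ᶜ),
          IsDiffDiffSubfield (Mer.dilation q hq) D F →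
          fixedSubfield (Mer.dilation q hq) ≤ F → Mer.X {0}ᶜ ∈ F →
          TranscendenceCriterion (Mer.dilation q hq) D F) := by
  have := Mer.charZero Set.univ
  have := Mer.charZero {0}ᶜ
  exact ⟨fun F hF hfix _ => transcendenceCriterion_of_commute Mer.ddx_shift hF hfix,
    fun q hq _ F hF hfix _ =>
      transcendenceCriterion_of_commute (Mer.euler_dilation q hq) hF hfix,
    fun D hD F hF hfix _ => transcendenceCriterion_of_commute hD hF hfix,
    fun q hq _ D hD F hF hfix _ => transcendenceCriterion_of_commute hD hF hfix⟩
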